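/- Fix constants $b\in\mathbb N$ and $c\in\mathbb R$. For $n\ge 2$ let $\mathcal X=\mathcal Y$ be the set of all $n$-qubit pure states $|\psi\rangle\langle\psi|$ (unit vectors of $(\mathbb C^2)^{\otimes n}$ up to global phase). Let $\mathcal E=\mathcal E_{n,b,c}$ be the class of all maps $f_C:\mathcal X\to\mathcal Y$, $|\psi\rangle\mapsto C|\psi\rangle$, where $C$ ranges over the $n$-qubit circuits consisting of at most $n^c$ unitary gates, each gate being an arbitrary unitary acting on at most $b$ of the qubits. Let the loss be the trace distance $$\mathcal L(y_1,y_2)=\tfrac12\bigl\||\psi(y_1)\rangle\langle\psi(y_1)|-|\psi(y_2)\rangle\langle\psi(y_2)|\bigr\|_1 .$$ For a probability measure $P$ on $\mathcal X\times\mathcal Y$ and a training set $S=((x_i,y_i))_{i=1}^m$ put $$R(f)=\int \mathcal L(y,f(x))\,dP(x,y),\qquad \hat R(f)=\frac1m\sum_{i=1}^m \mathcal L(y_i,f(x_i)).$$ Then $\mathcal E$ is PAC learnable by empirical risk minimization with sample complexity $$\nu(\epsilon,\delta)=O\Bigl(\tfrac1{\epsilon^2}\bigl(n^{c+1}\ln\tfrac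 n\epsilon+\ln\tfrac1\delta\bigr)\Bigr).$$ Precisely: there is a constant $K>0$ depending only on $b$ and $c$ such that for every $n\ge2$ there is a function $\nu:(0,1)^2\to\mathbb N$ with $$\nu(\epsilon,\delta)\le K\,\tfrac1{\epsilon^2}\bigl(n^{c+1}\ln\tfrac n\epsilon+\ln\tfrac1\delta\bigr)\quad\text{for all }(\epsilon,\delta)\in(0,1)^2,$$ and such that for all $(\epsilon,\delta)\in(0,1)^2$, every Borel probability measure $P$ on $\mathcal X\times\mathcal Y$ and every $m\ge\nu(\epsilon,\delta)$ the following holds. A minimizer $h$ of $R$ over $\mathcal E$ exists; for every training set $S$ of size $m$ a minimizer $\hat h$ of $\hat R$ over $\mathcal E$ exists; and, with probability at least $1-\delta$ over $S\sim P^m$, all such minimizers satisfy $R(\hat h)-R(h)\le\epsilon$. -/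

import Mathlib

open Matrix MeasureTheory
open scoped Kronecker

/-! ### PAC learning -/

section PAC

variable {X Y : Type*}

/-- The empirical risk `(1/m) ∑ᵢ L(yᵢ, f(xᵢ))` of `f` on the training set `S`. -/
noncomputable def empiricalRisk (L : Y → Y → ℝ) {m : ℕ} (S : Fin m → X × Y) (f : X → Y) : ℝ :=
  (1 / (m : ℝ)) * ∑ i, L (S i).2 (f (S i).1)

/-- The risk `∫ L(y, f(x)) dP(x, y)` of `f`. -/
noncomputable def risk [MeasurableSpace X] [MeasurableSpace Y] (L : Y → Y → ℝ)
    (P : Measure (X × Y)) (f : X → Y) : ℝ :=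
  ∫ p, L p.2 (f p.1) ∂P

/-- `h ∈ H` minimizes the functional `R` over the hypothesis space `H`. -/
def IsMinimizer (H : Set (X → Y)) (R : (X → Y) → ℝ) (h : X → Y) : Prop :=
  h ∈ H ∧ ∀ g ∈ H, R h ≤ R g

/-- The hypothesis space `H` is PAC learnable (by empirical risk minimization) for the loss `L`,
with sample complexity `ν`: for all `ε, δ ∈ (0, 1)`, every probability measure `P` on `X × Y` and
every sample size `m ≥ ν ε δ`, with probability at least `1 - δ` over `m` independent samples from
`P`, every empirical risk minimizer has risk within `ε` of the minimal risk.
That the minimizers referred to exist is part of the definition. The probability statement is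
given as an upper bound `δ` on the (outer) measure of the complementary event, which for a
non-measurable event is the stronger form. -/
def PACLearnable [MeasurableSpace X] [MeasurableSpace Y] (H : Set (X → Y)) (L : Y → Y → ℝ)
    (ν : ℝ → ℝ → ℕ) : Prop :=
  ∀ ε ∈ Set.Ioo (0 : ℝ) 1, ∀ δ ∈ Set.Ioo (0 : ℝ) 1,
    ∀ P : Measure (X × Y), ∀ _ : IsProbabilityMeasure P,
      (∃ h, IsMinimizer H (risk L P) h) ∧
      ∀ m : ℕ, ν ε δ ≤ m →
        (∀ S : Fin m → X × Y, ∃ h', IsMinimizer H (empiricalRisk L S) h') ∧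
        (Measure.pi fun _ : Fin m => P)
          {S | ∀ h' h, IsMinimizer H (empiricalRisk L S) h' → IsMinimizer H (risk L P) h →
            risk L P h' - risk L P h ≤ ε}ᶜ ≤ ENNReal.ofReal δ

end PAC

/-! ### Pure states and the trace distance -/

/-- The computational basis labels of a register whose qubits are indexed by `ι`. -/
abbrev Bits (ι : Type*) := ι → Fin 2

/-- The `n`-qubit pure states: a state vector `ψ` up to global phase, i.e. the projector `|ψ⟩⟨ψ|`
onto the line of a unit vector `ψ ∈ (ℂ²)^{⊗ n}`. -/
def PureState (n : ℕ) : Type :=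
  {ρ : Matrix (Bits (Fin n)) (Bits (Fin n)) ℂ //
    ∃ ψ : Bits (Fin n) → ℂ, star ψ ⬝ᵥ ψ = 1 ∧ ρ = vecMulVec ψ (star ψ)}

noncomputable instance (n : ℕ) : TopologicalSpace (PureState n) := instTopologicalSpaceSubtype

noncomputable instance (n : ℕ) : MeasurableSpace (PureState n) := borel (PureState n)

instance (n : ℕ) : BorelSpace (PureState n) := ⟨rfl⟩

/-- The trace norm `‖A‖₁ = tr √(Aᴴ A)`, the sum of the square roots of the eigenvalues of
`Aᴴ A`. -/
noncomputable def traceNorm {ι : Type*} [Fintype ι] [DecidableEq ι] (A : Matrix ι ι ℂ) : ℝ :=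
  ∑ i, √((isHermitian_conjTranspose_mul_self A).eigenvalues i)

/-- The trace distance `½ ‖ |ψ(y₁)⟩⟨ψ(y₁)| - |ψ(y₂)⟩⟨ψ(y₂)| ‖₁` of two pure states. -/
noncomputable def traceDistance {n : ℕ} (y₁ y₂ : PureState n) : ℝ :=
  (1 / 2) * traceNorm (y₁.1 - y₂.1)

/-- The map on pure states induced by a unitary: `|ψ⟩ ↦ U|ψ⟩`, i.e. `ρ ↦ U ρ Uᴴ`. -/
def applyUnitary {n : ℕ} (U : unitaryGroup (Bits (Fin n)) ℂ) (x : PureState n) : PureState n :=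
  ⟨U.1 * x.1 * U.1ᴴ, by
    obtain ⟨ψ, h1, h2⟩ := x.2
    refine ⟨U.1 *ᵥ ψ, ?_, ?_⟩
    · have hU : U.1ᴴ * U.1 = 1 := mem_unitaryGroup_iff'.1 U.2
      rw [star_mulVec, dotProduct_mulVec, vecMul_vecMul, hU, vecMul_one, h1]
    · rw [h2, star_mulVec, mul_vecMulVec, vecMulVec_mul]⟩

/-! ### Quantum circuits -/

/-- A unitary gate on an `n`-qubit register: a set of qubits and an arbitrary unitary
operation on these qubits. -/
structure Gate (n : ℕ) where
  support : Finset (Fin n)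
  op : unitaryGroup (Bits {i // i ∈ support}) ℂ

/-- The unitary `V ⊗ 1` on all `n` qubits performed by a gate `V` acting on some of them. -/
noncomputable def Gate.unitary {n : ℕ} (g : Gate n) : unitaryGroup (Bits (Fin n)) ℂ :=
  ⟨reindex (Equiv.piEquivPiSubtypeProd (fun i => i ∈ g.support) (fun _ => Fin 2)).symm
      (Equiv.piEquivPiSubtypeProd (fun i => i ∈ g.support) (fun _ => Fin 2)).symm
      (g.op.1 ⊗ₖ (1 : Matrix (Bits {i // i ∉ g.support}) (Bits {i // i ∉ g.support}) ℂ)), by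
    have h := kronecker_mem_unitary g.op.2
      (one_mem (unitaryGroup (Bits {i // i ∉ g.support}) ℂ))
    have h' := (Unitary.mem_iff.1 h).2
    rw [mem_unitaryGroup_iff, star_eq_conjTranspose, conjTranspose_reindex, reindex_apply,
      reindex_apply, submatrix_mul_equiv, ← star_eq_conjTranspose, h', submatrix_one_equiv]⟩

/-- The unitary `U_l ⋯ U_2 U_1` performed by the circuit with gates `[U_1, U_2, …, U_l]`. -/
noncomputable def circuitUnitary {n : ℕ} : List (Gate n) → unitaryGroup (Bits (Fin n)) ℂ
  | [] => 1
  | g :: C => circuitUnitary C * g.unitary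

/-- The class of the maps `f_C` on `n`-qubit pure states, for `C` an `n`-qubit circuit with at
most `n ^ c` unitary gates, each acting on at most `b` qubits. -/
def circuitClass (n b : ℕ) (c : ℝ) : Set (PureState n → PureState n) :=
  {f | ∃ C : List (Gate n), (C.length : ℝ) ≤ (n : ℝ) ^ c ∧ (∀ g ∈ C, g.support.card ≤ b) ∧
    f = applyUnitary (circuitUnitary C)}

/-! For `c < 0` only the empty circuit is allowed and the class is a single map. For `c ≥ 0` the
proof is a covering-number argument with `N = ⌊n ^ c⌋` gates. If finitely many maps approximate the
class uniformly up to `ε / 8`, Hoeffding's inequality on these maps and a union bound control every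
empirical risk at once, so empirical risk minimization is `ε`-optimal (`measure_erm_gap_le`).

For pure states the trace distance is the Frobenius distance divided by `√2` (`traceDistance_eq`),
hence a unitarily invariant metric, and the errors made by discretizing single gates add up along a
circuit (`exists_circuit_net`). A gate on at most `b` qubits has at most `2 * 4 ^ b` real
parameters, which are put on a grid, and at most `2 ^ n` supports. The net has at most `(128 N 2 ^ n
/ ε) ^ (O(4 ^ b) N)` elements. Its logarithm is of order `N (n + ln (N / ε))`, which is `O(n ^ (c +
1) ln (n / ε))` for fixed `b` and `c`; the crude factors `2 ^ n` cost only the extra power of `n`.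

Minimizers exist because the unitaries of the admissible circuits form a compact set on which both
risks are continuous. -/

/-! ### Uniform convergence and empirical risk minimization -/

section UniformConvergence

open ProbabilityTheory

/-- Two-sided Hoeffding inequality for the empirical mean of a `[0, 1]`-valued function. -/
theorem measure_empiricalMean_deviation_le {Ω : Type*} [MeasurableSpace Ω] (P : Measure Ω)
    [IsProbabilityMeasure P] {f : Ω → ℝ} (hf : Measurable f) (hf01 : ∀ ω, f ω ∈ Set.Icc (0 : ℝ) 1)
    {m : ℕ} (hm : 0 < m) {t : ℝ} (ht : 0 ≤ t) :
    (Measure.pi fun _ : Fin m => P) {S | t ≤ |(1 / (m : ℝ)) * ∑ i, f (S i) - ∫ ω, f ω ∂P|} ≤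
      ENNReal.ofReal (2 * Real.exp (-(2 * m * t ^ 2))) := by
  set Q := Measure.pi fun _ : Fin m => P
  set μ := ∫ ω, f ω ∂P
  have hm' : (0 : ℝ) < m := by exact_mod_cast hm
  have hint (i : Fin m) : ∫ S, f (S i) ∂Q = μ := by
    have h := measurePreserving_eval (fun _ : Fin m => P) i
    have h' := integral_map (μ := Q) h.measurable.aemeasurable
      (f := f) (by rw [h.map_eq]; exact hf.aestronglyMeasurable)
    rw [h.map_eq] at h'
    exact h'.symm
  have hsub (i : Fin m) : HasSubgaussianMGF (fun S : Fin m → Ω => f (S i) - μ)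
      ((‖(1 : ℝ) - 0‖₊ / 2) ^ 2) Q := by
    rw [← hint i]
    exact hasSubgaussianMGF_of_mem_Icc (hf.comp (measurable_pi_apply i)).aemeasurable
      (ae_of_all _ fun S => hf01 (S i))
  have hind : iIndepFun (fun (i : Fin m) (S : Fin m → Ω) => f (S i) - μ) Q :=
    iIndepFun_pi (X := fun _ ω => f ω - μ) fun _ => (hf.sub_const μ).aemeasurable
  have hindneg : iIndepFun (fun (i : Fin m) (S : Fin m → Ω) => -(f (S i) - μ)) Q :=
    iIndepFun_pi (X := fun _ ω => -(f ω - μ)) fun _ => (hf.sub_const μ).neg.aemeasurable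
  have hmt : 0 ≤ m * t := by positivity
  -- Each summand has variance proxy `1 / 4` by Hoeffding's lemma, so the exponent is `(m t)² / (2 ·
  -- m / 4)`.
  have hexp : -(m * t) ^ 2 / (2 * ((∑ _i : Fin m, (‖(1 : ℝ) - 0‖₊ / 2) ^ 2 : NNReal) : ℝ)) =
      -(2 * m * t ^ 2) := by
    simp
    field_simp
  have h₁ := HasSubgaussianMGF.measure_sum_ge_le_of_iIndepFun hind
    (s := Finset.univ) (fun i _ => hsub i) hmt
  have h₂ := HasSubgaussianMGF.measure_sum_ge_le_of_iIndepFun hindneg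
    (s := Finset.univ) (fun i _ => (hsub i).neg) hmt
  rw [hexp] at h₁ h₂
  have hsubset : {S : Fin m → Ω | t ≤ |(1 / (m : ℝ)) * ∑ i, f (S i) - μ|} ⊆
      {S | m * t ≤ ∑ i, (f (S i) - μ)} ∪ {S | m * t ≤ ∑ i, -(f (S i) - μ)} := by
    intro S hS
    have hsum : ∑ i, (f (S i) - μ) = m * ((1 / (m : ℝ)) * ∑ i, f (S i) - μ) := by
      rw [Finset.sum_sub_distrib]
      simp
      field_simp
    simp only [Set.mem_union, Set.mem_ofPred_eq, Finset.sum_neg_distrib, hsum, ← mul_neg,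
      mul_le_mul_iff_right₀ hm']
    exact le_abs.1 hS
  calc Q _ ≤ Q _ + Q _ := (measure_mono hsubset).trans (measure_union_le _ _)
    _ = ENNReal.ofReal (Q.real _) + ENNReal.ofReal (Q.real _) := by
      rw [ofReal_measureReal, ofReal_measureReal]
    _ ≤ ENNReal.ofReal (Real.exp _) + ENNReal.ofReal (Real.exp _) :=
      add_le_add (ENNReal.ofReal_le_ofReal h₁) (ENNReal.ofReal_le_ofReal h₂)
    _ = _ := by rw [← ENNReal.ofReal_add (by positivity) (by positivity), ← two_mul]

theorem abs_empiricalRisk_sub_empiricalRisk_le {X Y : Type*} {L : Y → Y → ℝ} {f g : X → Y}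
    {m : ℕ} (hm : 0 < m) (S : Fin m → X × Y) {η : ℝ} (h : ∀ x y, |L y (f x) - L y (g x)| ≤ η) :
    |empiricalRisk L S f - empiricalRisk L S g| ≤ η := by
  have hm' : (0 : ℝ) < m := by exact_mod_cast hm
  rw [empiricalRisk, empiricalRisk, ← mul_sub, ← Finset.sum_sub_distrib, abs_mul,
    abs_of_pos (by positivity : 0 < 1 / (m : ℝ)), one_div, inv_mul_le_iff₀ hm']
  refine (Finset.abs_sum_le_sum_abs _ _).trans ?_
  refine (Finset.sum_le_card_nsmul _ _ η fun i _ => h _ _).trans ?_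
  simp

variable {X Y : Type*} [MeasurableSpace X] [MeasurableSpace Y]

theorem integrable_loss {L : Y → Y → ℝ} {P : Measure (X × Y)} [IsProbabilityMeasure P] {f : X → Y}
    (hL : ∀ y y', L y y' ∈ Set.Icc (0 : ℝ) 1) (hf : Measurable fun p : X × Y => L p.2 (f p.1)) :
    Integrable (fun p : X × Y => L p.2 (f p.1)) P :=
  Integrable.of_mem_Icc 0 1 hf.aemeasurable (ae_of_all _ fun _ => hL _ _)

theorem abs_risk_sub_risk_le {L : Y → Y → ℝ} {P : Measure (X × Y)} [IsProbabilityMeasure P]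
    {f g : X → Y} (hL : ∀ y y', L y y' ∈ Set.Icc (0 : ℝ) 1)
    (hf : Measurable fun p : X × Y => L p.2 (f p.1))
    (hg : Measurable fun p : X × Y => L p.2 (g p.1)) {η : ℝ}
    (h : ∀ x y, |L y (f x) - L y (g x)| ≤ η) : |risk L P f - risk L P g| ≤ η := by
  rw [risk, risk, ← integral_sub (integrable_loss hL hf) (integrable_loss hL hg)]
  simpa using norm_integral_le_of_norm_le_const (μ := P)
    (ae_of_all _ fun p : X × Y => (Real.norm_eq_abs _).trans_le (h p.1 p.2))

/-- If finitely many functions approximate the hypothesis space uniformly up to `ε / 8`, then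
empirical risk minimization is `ε`-optimal except with exponentially small probability. -/
theorem measure_erm_gap_le {H : Set (X → Y)} {L : Y → Y → ℝ} (P : Measure (X × Y))
    [IsProbabilityMeasure P] (T : Finset (X → Y)) {ε : ℝ} (hε : 0 < ε)
    (hL : ∀ y y', L y y' ∈ Set.Icc (0 : ℝ) 1)
    (hH : ∀ f ∈ H, Measurable fun p : X × Y => L p.2 (f p.1))
    (hT : ∀ f ∈ T, Measurable fun p : X × Y => L p.2 (f p.1))
    (hHT : ∀ f ∈ H, ∃ g ∈ T, ∀ x y, |L y (f x) - L y (g x)| ≤ ε / 8) {m : ℕ} (hm : 0 < m) :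
    (Measure.pi fun _ : Fin m => P)
      {S | ∀ h' h, IsMinimizer H (empiricalRisk L S) h' → IsMinimizer H (risk L P) h →
        risk L P h' - risk L P h ≤ ε}ᶜ ≤
      ENNReal.ofReal (T.card * (2 * Real.exp (-(m * ε ^ 2 / 8)))) := by
  have hsubset : {S : Fin m → X × Y | ∀ h' h, IsMinimizer H (empiricalRisk L S) h' →
      IsMinimizer H (risk L P) h → risk L P h' - risk L P h ≤ ε}ᶜ ⊆
      ⋃ g ∈ T, {S | ε / 4 ≤ |empiricalRisk L S g - risk L P g|} := by
    intro S hS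
    by_contra hcon
    simp only [Set.mem_iUnion, Set.mem_ofPred_eq, exists_prop, not_exists, not_and, not_le] at hcon
    -- Passing through the net point costs `ε / 8 + ε / 4 + ε / 8`.
    have hdev : ∀ f ∈ H, |empiricalRisk L S f - risk L P f| ≤ ε / 2 := by
      intro f hf
      obtain ⟨g, hg, hfg⟩ := hHT f hf
      have h₁ := abs_le.1 (abs_risk_sub_risk_le (P := P) hL (hH f hf) (hT g hg) hfg)
      have h₂ := abs_le.1 (abs_empiricalRisk_sub_empiricalRisk_le hm S hfg)
      have h₃ := abs_lt.1 (hcon g hg)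
      exact abs_le.2 ⟨by linarith, by linarith⟩
    refine hS fun h' h hh' hh => ?_
    have h₁ := abs_le.1 (hdev h' hh'.1)
    have h₂ := abs_le.1 (hdev h hh.1)
    have h₃ := hh'.2 h hh.1
    linarith
  refine (measure_mono hsubset).trans ((measure_biUnion_finset_le _ _).trans ?_)
  refine (Finset.sum_le_card_nsmul T _ (ENNReal.ofReal (2 * Real.exp (-(m * ε ^ 2 / 8)))) ?_).trans
    (le_of_eq ?_)
  · intro g hg
    have h := measure_empiricalMean_deviation_le P (hT g hg) (fun p => hL _ _) hm
      (by positivity : 0 ≤ ε / 4)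
    rwa [show 2 * (m : ℝ) * (ε / 4) ^ 2 = m * ε ^ 2 / 8 by ring] at h
  · rw [nsmul_eq_mul, ENNReal.ofReal_mul (Nat.cast_nonneg _), ENNReal.ofReal_natCast]

end UniformConvergence

/-! ### The trace distance of pure states as a Hilbert–Schmidt distance -/

section TraceDistance

/-- If `(AᴴA)² = s AᴴA`, then the eigenvalues of `AᴴA` are `0` and `s`, so that
`√s ‖A‖₁ = tr AᴴA`. -/
theorem sqrt_mul_traceNorm {ι : Type*} [Fintype ι] [DecidableEq ι] {A : Matrix ι ι ℂ} {s : ℝ}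
    (h : (Aᴴ * A) * (Aᴴ * A) = (s : ℂ) • (Aᴴ * A)) :
    √s * traceNorm A = (Aᴴ * A).trace.re ∧ (s = 0 → traceNorm A = 0) := by
  have hB := isHermitian_conjTranspose_mul_self A
  have hev (i : ι) : hB.eigenvalues i * hB.eigenvalues i = s * hB.eigenvalues i := by
    have h₁ := hB.mulVec_eigenvectorBasis i
    have h₂ := congrArg (· *ᵥ (hB.eigenvectorBasis i).ofLp) h
    simp only [← mulVec_mulVec, smul_mulVec, h₁, mulVec_smul] at h₂
    have hne : (hB.eigenvectorBasis i).ofLp ≠ 0 := by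
      intro h0
      have := hB.eigenvectorBasis.orthonormal.ne_zero i
      exact this (by ext j; simpa using congrFun h0 j)
    obtain ⟨j, hj⟩ := Function.ne_iff.1 hne
    have h₃ := congrFun h₂ j
    simp only [Pi.smul_apply, Complex.real_smul, smul_eq_mul, ← mul_assoc] at h₃
    exact_mod_cast mul_right_cancel₀ hj h₃
  have hnn (i : ι) : 0 ≤ hB.eigenvalues i := eigenvalues_conjTranspose_mul_self_nonneg A i
  have hev' (i : ι) : hB.eigenvalues i = 0 ∨ hB.eigenvalues i = s := by
    rcases eq_or_ne (hB.eigenvalues i) 0 with h0 | h0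
    · exact .inl h0
    · exact .inr (mul_right_cancel₀ h0 (hev i))
  constructor
  · rw [traceNorm, Finset.mul_sum, hB.trace_eq_sum_eigenvalues, Complex.re_sum]
    refine Finset.sum_congr rfl fun i _ => ?_
    rcases hev' i with h0 | h0
    · simp [h0]
    · have := hnn i
      rw [h0] at this ⊢
      simp [Real.mul_self_sqrt this]
  -- For `s = 0` the first identity says nothing about `traceNorm A`, so this case is recorded
  -- separately.
  · rintro rfl
    exact Finset.sum_eq_zero fun i _ => by rcases hev' i with h0 | h0 <;> simp [h0]

variable {n : ℕ}

open scoped Matrix.Norms.Frobenius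

theorem frobenius_norm_sq {ι κ : Type*} [Fintype ι] [Fintype κ] (A : Matrix ι κ ℂ) :
    ‖A‖ ^ 2 = (Aᴴ * A).trace.re := by
  rw [frobenius_norm_def, ← Real.sqrt_eq_rpow, Real.sq_sqrt (by positivity), Finset.sum_comm]
  simp [trace, mul_apply, Complex.re_sum, Complex.sq_norm, Complex.normSq_apply]

theorem PureState.conjTranspose_eq (x : PureState n) : x.1ᴴ = x.1 := by
  obtain ⟨ψ, -, h⟩ := x.2
  rw [h, conjTranspose_vecMulVec, star_star]

theorem PureState.mul_self (x : PureState n) : x.1 * x.1 = x.1 := by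
  obtain ⟨ψ, h1, h⟩ := x.2
  rw [h, vecMulVec_mul_vecMulVec, h1, one_smul]

theorem PureState.trace_eq_one (x : PureState n) : x.1.trace = 1 := by
  obtain ⟨ψ, h1, h⟩ := x.2
  rw [h, trace_vecMulVec, dotProduct_comm, h1]

theorem PureState.norm_eq_one (x : PureState n) : ‖x.1‖ = 1 := by
  have h := frobenius_norm_sq x.1
  rw [x.conjTranspose_eq, x.mul_self, x.trace_eq_one, Complex.one_re] at h
  exact (pow_eq_one_iff_of_nonneg (norm_nonneg _) two_ne_zero).1 h

/-- Compressing to a rank-one projector leaves a scalar. This makes the cube of `x - y` a multiple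
of `x - y`. -/
theorem PureState.mul_mul_eq_smul (x y : PureState n) :
    x.1 * y.1 * x.1 = ((x.1 * y.1).trace) • x.1 := by
  obtain ⟨ψ, h1, h⟩ := x.2
  obtain ⟨φ, h1', h'⟩ := y.2
  rw [h, h', vecMulVec_mul_vecMulVec, vecMulVec_smul, trace_smul, smul_mul_assoc,
    vecMulVec_mul_vecMulVec, vecMulVec_smul, trace_vecMulVec, smul_smul, smul_eq_mul,
    dotProduct_comm ψ]

/-- The trace of a product of two pure states is a nonnegative real number, determined by their
Hilbert–Schmidt distance. -/
theorem PureState.trace_mul_eq (x y : PureState n) :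
    (x.1 * y.1).trace = ((1 - ‖x.1 - y.1‖ ^ 2 / 2 : ℝ) : ℂ) ∧ 0 ≤ 1 - ‖x.1 - y.1‖ ^ 2 / 2 := by
  have hsq : ((x.1 * y.1).trace).re = 1 - ‖x.1 - y.1‖ ^ 2 / 2 := by
    rw [frobenius_norm_sq, conjTranspose_sub, x.conjTranspose_eq, y.conjTranspose_eq, sub_mul,
      mul_sub, mul_sub, x.mul_self, y.mul_self, trace_sub, trace_sub, trace_sub, x.trace_eq_one,
      y.trace_eq_one, trace_mul_comm y.1]
    simp
    ring
  obtain ⟨ψ, h1, h⟩ := x.2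
  obtain ⟨φ, h1', h'⟩ := y.2
  have hnn : (x.1 * y.1).trace = ((‖star ψ ⬝ᵥ φ‖ ^ 2 : ℝ) : ℂ) := by
    rw [h, h', vecMulVec_mul_vecMulVec, vecMulVec_smul, trace_smul, trace_vecMulVec, smul_eq_mul,
      show ψ ⬝ᵥ star φ = star (star ψ ⬝ᵥ φ) by rw [star_dotProduct, star_star, dotProduct_comm],
      Complex.star_def, Complex.mul_conj, Complex.normSq_eq_norm_sq]
  rw [← hsq, hnn]
  exact ⟨by rw [Complex.ofReal_re], by rw [Complex.ofReal_re]; positivity⟩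

/-- For pure states, the trace distance is the Hilbert–Schmidt distance up to a factor `√2`. -/
theorem traceDistance_eq (x y : PureState n) : traceDistance x y = ‖x.1 - y.1‖ / √2 := by
  obtain ⟨ht, ht0⟩ := x.trace_mul_eq y
  set d := ‖x.1 - y.1‖
  have hA : (x.1 - y.1)ᴴ = x.1 - y.1 := by
    rw [conjTranspose_sub, x.conjTranspose_eq, y.conjTranspose_eq]
  have hxy := x.mul_mul_eq_smul y
  have hyx := y.mul_mul_eq_smul x
  rw [trace_mul_comm y.1, ht] at hyx
  rw [ht] at hxy
  -- The scalar is `1 - tr (x y) = d² / 2`. It follows that `AᴴA` has only the eigenvalues `0` and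
  -- `d² / 2`, and `sqrt_mul_traceNorm` yields `(d / √2) ‖A‖₁ = d²`.
  have h3 : (x.1 - y.1) * (x.1 - y.1) * (x.1 - y.1) = ((d ^ 2 / 2 : ℝ) : ℂ) • (x.1 - y.1) := by
    have e : (x.1 - y.1) * (x.1 - y.1) * (x.1 - y.1) = (x.1 - x.1 * y.1 * x.1) -
        (y.1 - y.1 * x.1 * y.1) := by
      have hx := x.mul_self
      have hy := y.mul_self
      have e1 : x.1 * y.1 * y.1 = x.1 * y.1 := by rw [mul_assoc, hy]
      have e2 : y.1 * x.1 * x.1 = y.1 * x.1 := by rw [mul_assoc, hx]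
      simp only [sub_mul, mul_sub, hx, hy, e1, e2]
      abel
    rw [e, hxy, hyx]
    push_cast
    module
  have h4 : ((x.1 - y.1)ᴴ * (x.1 - y.1)) * ((x.1 - y.1)ᴴ * (x.1 - y.1)) =
      ((d ^ 2 / 2 : ℝ) : ℂ) • ((x.1 - y.1)ᴴ * (x.1 - y.1)) := by
    rw [hA, ← mul_assoc, h3, smul_mul_assoc]
  obtain ⟨h5, h6⟩ := sqrt_mul_traceNorm h4
  rw [← frobenius_norm_sq] at h5
  change _ = d ^ 2 at h5
  have hd : 0 ≤ d := norm_nonneg _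
  rw [traceDistance]
  rcases hd.eq_or_lt with h0 | h0
  · rw [h6 (by rw [← h0]; simp), ← h0]
    simp
  · rw [Real.sqrt_div (by positivity), Real.sqrt_sq hd] at h5
    have h2 : √2 * √2 = (2 : ℝ) := Real.mul_self_sqrt (by norm_num)
    have h2' : 0 < √(2 : ℝ) := by positivity
    field_simp at h5 ⊢
    nlinarith

theorem traceDistance_mem_Icc (x y : PureState n) : traceDistance x y ∈ Set.Icc (0 : ℝ) 1 := by
  rw [traceDistance_eq]
  refine ⟨by positivity, (div_le_one (by positivity)).2 (Real.le_sqrt_of_sq_le ?_)⟩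
  have := (x.trace_mul_eq y).2
  linarith

theorem traceDistance_comm (x y : PureState n) : traceDistance x y = traceDistance y x := by
  rw [traceDistance_eq, traceDistance_eq, norm_sub_rev]

theorem traceDistance_triangle (x y z : PureState n) :
    traceDistance x z ≤ traceDistance x y + traceDistance y z := by
  simp only [traceDistance_eq, ← add_div]
  gcongr
  exact norm_sub_le_norm_sub_add_norm_sub _ _ _

theorem abs_traceDistance_sub_le (x y z : PureState n) :
    |traceDistance x y - traceDistance x z| ≤ traceDistance y z := by
  have h₁ := traceDistance_triangle x y z
  have h₂ := traceDistance_triangle x z y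
  rw [traceDistance_comm z y] at h₂
  exact abs_le.2 ⟨by linarith, by linarith⟩

theorem continuous_traceDistance {α : Type*} [TopologicalSpace α] {f g : α → PureState n}
    (hf : Continuous f) (hg : Continuous g) : Continuous fun a => traceDistance (f a) (g a) := by
  simp only [traceDistance_eq]
  have h : Continuous fun a => (f a).1 - (g a).1 :=
    (continuous_subtype_val.comp hf).sub (continuous_subtype_val.comp hg)
  exact h.norm.div_const _

theorem traceDistance_self (x : PureState n) : traceDistance x x = 0 := by
  rw [traceDistance_eq, sub_self, norm_zero, zero_div]

/-! ### The action of unitaries on pure states -/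

theorem frobenius_norm_unitary_mul {ι κ : Type*} [Fintype ι] [DecidableEq ι] [Fintype κ]
    (U : unitaryGroup ι ℂ) (A : Matrix ι κ ℂ) : ‖U.1 * A‖ = ‖A‖ := by
  have h : ‖U.1 * A‖ ^ 2 = ‖A‖ ^ 2 := by
    rw [frobenius_norm_sq, frobenius_norm_sq, conjTranspose_mul, Matrix.mul_assoc,
      ← Matrix.mul_assoc U.1ᴴ, ← star_eq_conjTranspose U.1, mem_unitaryGroup_iff'.1 U.2,
      Matrix.one_mul]
  exact (pow_left_inj₀ (norm_nonneg _) (norm_nonneg _) two_ne_zero).1 h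

theorem frobenius_norm_mul_conjTranspose_unitary {ι κ : Type*} [Fintype ι] [DecidableEq ι]
    [Fintype κ] (U : unitaryGroup ι ℂ) (A : Matrix κ ι ℂ) : ‖A * U.1ᴴ‖ = ‖A‖ := by
  rw [← frobenius_norm_conjTranspose, conjTranspose_mul, conjTranspose_conjTranspose,
    frobenius_norm_unitary_mul, frobenius_norm_conjTranspose]

theorem applyUnitary_mul (U V : unitaryGroup (Bits (Fin n)) ℂ) (x : PureState n) :
    applyUnitary (U * V) x = applyUnitary U (applyUnitary V x) :=
  Subtype.ext (by simp [applyUnitary, conjTranspose_mul, mul_assoc])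

theorem traceDistance_applyUnitary (U : unitaryGroup (Bits (Fin n)) ℂ) (x y : PureState n) :
    traceDistance (applyUnitary U x) (applyUnitary U y) = traceDistance x y := by
  rw [traceDistance_eq, traceDistance_eq]
  simp only [applyUnitary]
  rw [← sub_mul, ← mul_sub, frobenius_norm_mul_conjTranspose_unitary, frobenius_norm_unitary_mul]

theorem traceDistance_applyUnitary_le (U V : unitaryGroup (Bits (Fin n)) ℂ) (x : PureState n) :
    traceDistance (applyUnitary U x) (applyUnitary V x) ≤ 2 * ‖U.1 - V.1‖ := by
  rw [traceDistance_eq]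
  simp only [applyUnitary]
  -- Replacing one factor at a time gives two terms of norm at most `‖U - V‖`; the gain of `1 / √2`
  -- is discarded.
  have h : U.1 * x.1 * U.1ᴴ - V.1 * x.1 * V.1ᴴ =
      (U.1 - V.1) * x.1 * U.1ᴴ + V.1 * (x.1 * (U.1 - V.1)ᴴ) := by
    rw [conjTranspose_sub]
    noncomm_ring
  have h₁ : ‖(U.1 - V.1) * x.1 * U.1ᴴ‖ ≤ ‖U.1 - V.1‖ := by
    rw [frobenius_norm_mul_conjTranspose_unitary]
    simpa [x.norm_eq_one] using frobenius_norm_mul (U.1 - V.1) x.1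
  have h₂ : ‖V.1 * (x.1 * (U.1 - V.1)ᴴ)‖ ≤ ‖U.1 - V.1‖ := by
    rw [frobenius_norm_unitary_mul]
    simpa [x.norm_eq_one, -conjTranspose_sub, frobenius_norm_conjTranspose] using
      frobenius_norm_mul x.1 (U.1 - V.1)ᴴ
  have h₃ : (1 : ℝ) ≤ √2 := Real.one_le_sqrt.2 (by norm_num)
  rw [h]
  refine (div_le_self (norm_nonneg _) h₃).trans ((norm_add_le _ _).trans ?_)
  linarith

theorem continuous_applyUnitary {α : Type*} [TopologicalSpace α]
    {U : α → unitaryGroup (Bits (Fin n)) ℂ} {f : α → PureState n}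
    (hU : Continuous U) (hf : Continuous f) : Continuous fun a => applyUnitary (U a) (f a) := by
  refine Continuous.subtype_mk ?_ _
  have hU' : Continuous fun a => (U a).1 := continuous_subtype_val.comp hU
  have hf' : Continuous fun a => (f a).1 := continuous_subtype_val.comp hf
  exact (hU'.matrix_mul hf').matrix_mul hU'.matrix_conjTranspose

end TraceDistance

/-! ### Finite nets of gates and circuits -/

section Nets

/-- Entrywise finite nets of the unitary group. -/
theorem exists_unitary_net (ι : Type*) [Fintype ι] [DecidableEq ι] {M : ℕ} (hM : 0 < M) :
    ∃ T : Finset (unitaryGroup ι ℂ), T.card ≤ (2 * M + 1) ^ (2 * Fintype.card ι ^ 2) ∧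
      ∀ U : unitaryGroup ι ℂ, ∃ V ∈ T, ∀ i j, ‖U.1 i j - V.1 i j‖ ≤ 2 / M := by
  classical
  have hM' : (0 : ℝ) < M := by exact_mod_cast hM
  have hlt {r : ℝ} (hr : |r| ≤ 1) : ⌊(r + 1) * M⌋₊ < 2 * M + 1 := by
    rw [Nat.lt_succ_iff]
    refine Nat.floor_le_of_le ?_
    push_cast
    have := (abs_le.1 hr).2
    gcongr
    linarith
  have hclose {r s : ℝ} (hr : |r| ≤ 1) (hs : |s| ≤ 1)
      (h : ⌊(r + 1) * M⌋₊ = ⌊(s + 1) * M⌋₊) : |r - s| ≤ 1 / M := by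
    have hr' : 0 ≤ (r + 1) * M := mul_nonneg (by linarith [(abs_le.1 hr).1]) hM'.le
    have hs' : 0 ≤ (s + 1) * M := mul_nonneg (by linarith [(abs_le.1 hs).1]) hM'.le
    have h₁ := Nat.floor_le hr'
    have h₂ := Nat.lt_floor_add_one ((r + 1) * M)
    have h₃ := Nat.floor_le hs'
    have h₄ := Nat.lt_floor_add_one ((s + 1) * M)
    rw [h] at h₁ h₂
    have h₅ : |(r - s) * M| ≤ 1 := abs_le.2 ⟨by linarith, by linarith⟩
    rwa [abs_mul, abs_of_pos hM', ← le_div_iff₀ hM'] at h₅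
  have hre (U : unitaryGroup ι ℂ) (i j : ι) : |(U.1 i j).re| ≤ 1 :=
    (Complex.abs_re_le_norm _).trans (entry_norm_bound_of_unitary U.2 i j)
  have him (U : unitaryGroup ι ℂ) (i j : ι) : |(U.1 i j).im| ≤ 1 :=
    (Complex.abs_im_le_norm _).trans (entry_norm_bound_of_unitary U.2 i j)
  -- The label is the grid cell of all real and imaginary parts, each shifted from `[-1, 1]` to `[0,
  -- 2M]`. One unitary is chosen per occupied cell, so that the net consists of unitaries; the
  -- arbitrary values at empty cells do no harm.
  let label (U : unitaryGroup ι ℂ) : ι × ι → Fin (2 * M + 1) × Fin (2 * M + 1) := fun p =>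
    (⟨⌊((U.1 p.1 p.2).re + 1) * M⌋₊, hlt (hre U _ _)⟩,
      ⟨⌊((U.1 p.1 p.2).im + 1) * M⌋₊, hlt (him U _ _)⟩)
  refine ⟨Finset.univ.image (Function.invFun label), ?_, fun U => ⟨Function.invFun label (label U),
    Finset.mem_image_of_mem _ (Finset.mem_univ _), fun i j => ?_⟩⟩
  · refine Finset.card_image_le.trans (le_of_eq ?_)
    simp only [Finset.card_univ, Fintype.card_fun, Fintype.card_prod, Fintype.card_fin]
    rw [← sq, ← pow_mul, sq (Fintype.card ι)]
  · have h := congrFun (Function.invFun_eq (f := label) ⟨U, rfl⟩) (i, j)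
    simp only [label, Prod.mk.injEq, Fin.mk.injEq] at h
    have h₁ := hclose (hre _ _ _) (hre _ _ _) h.1.symm
    have h₂ := hclose (him _ _ _) (him _ _ _) h.2.symm
    refine (Complex.norm_le_abs_re_add_abs_im _).trans ?_
    rw [Complex.sub_re, Complex.sub_im]
    calc _ ≤ 1 / (M : ℝ) + 1 / M := add_le_add h₁ h₂
      _ = 2 / M := by ring

variable {n : ℕ}

theorem Gate.unitary_apply (g : Gate n) (i j : Bits (Fin n)) :
    g.unitary.1 i j = g.op.1 (fun k => i k) (fun k => j k) *
      (1 : Matrix (Bits {k // k ∉ g.support}) (Bits {k // k ∉ g.support}) ℂ)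
        (fun k => i k) (fun k => j k) := rfl

open scoped Matrix.Norms.Frobenius in
/-- Gates on the same qubits with entrywise close operations have close unitaries. -/
theorem Gate.norm_unitary_sub_le (s : Finset (Fin n)) (U V : unitaryGroup (Bits {i // i ∈ s}) ℂ)
    {η : ℝ} (hη : 0 ≤ η) (h : ∀ i j, ‖U.1 i j - V.1 i j‖ ≤ η) :
    ‖(Gate.mk s U).unitary.1 - (Gate.mk s V).unitary.1‖ ≤ 2 ^ n * η := by
  -- An entry of the difference is `0` or an entry of `U - V`, and there are `2 ^ n * 2 ^ n` of
  -- them.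
  have hentry (i j) : ‖((Gate.mk s U).unitary.1 - (Gate.mk s V).unitary.1) i j‖ ≤ η := by
    rw [Matrix.sub_apply, Gate.unitary_apply, Gate.unitary_apply, ← sub_mul, norm_mul]
    refine (mul_le_of_le_one_right (norm_nonneg _) ?_).trans (h _ _)
    rw [one_apply]
    split_ifs <;> simp
  rw [frobenius_norm_def, ← Real.sqrt_eq_rpow]
  refine Real.sqrt_le_iff.2 ⟨by positivity, ?_⟩
  calc _ ≤ ∑ _i : Bits (Fin n), ∑ _j : Bits (Fin n), η ^ 2 := by
        refine Finset.sum_le_sum fun i _ => Finset.sum_le_sum fun j _ => ?_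
        rw [Real.rpow_two]
        exact pow_le_pow_left₀ (norm_nonneg _) (hentry i j) 2
    _ = _ := by
      simp
      ring

open scoped Matrix.Norms.Frobenius in
/-- Finite nets of the gates acting on at most `b` qubits. -/
theorem exists_gate_net (n b : ℕ) {M : ℕ} (hM : 0 < M) :
    ∃ T : Finset (Gate n), T.card ≤ 2 ^ n * (2 * M + 1) ^ (2 * (2 ^ b) ^ 2) ∧
      ∀ g : Gate n, g.support.card ≤ b →
        ∃ g' ∈ T, ‖g.unitary.1 - g'.unitary.1‖ ≤ 2 ^ n * (2 / M) := by
  classical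
  choose T hcard hT using fun s : Finset (Fin n) => exists_unitary_net (Bits {i // i ∈ s}) hM
  refine ⟨(Finset.univ.filter fun s : Finset (Fin n) => s.card ≤ b).biUnion
    fun s => (T s).image (Gate.mk s), ?_, ?_⟩
  · refine (Finset.card_biUnion_le_card_mul _ _ ((2 * M + 1) ^ (2 * (2 ^ b) ^ 2)) ?_).trans ?_
    · intro s hs
      refine Finset.card_image_le.trans ((hcard s).trans ?_)
      have hs' : s.card ≤ b := (Finset.mem_filter.1 hs).2
      simp only [Fintype.card_fun, Fintype.card_fin, Fintype.card_coe]
      gcongr <;> omega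
    · refine Nat.mul_le_mul_right _ ((Finset.card_le_univ _).trans (le_of_eq ?_))
      simp
  · rintro ⟨s, U⟩ hs
    obtain ⟨V, hV, hUV⟩ := hT s U
    exact ⟨⟨s, V⟩, Finset.mem_biUnion.2 ⟨s, by simpa using hs, Finset.mem_image_of_mem _ hV⟩,
      Gate.norm_unitary_sub_le s U V (by positivity) hUV⟩

/-- A net of gates yields a net of circuits. -/
theorem exists_circuit_net {b : ℕ} {G : Finset (Gate n)} {η : ℝ} (hη : 0 ≤ η)
    (hG : ∀ g : Gate n, g.support.card ≤ b → ∃ g' ∈ G, ∀ x,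
      traceDistance (applyUnitary g.unitary x) (applyUnitary g'.unitary x) ≤ η) (k : ℕ) :
    ∃ T : Finset (unitaryGroup (Bits (Fin n)) ℂ), T.card ≤ (G.card + 1) ^ k ∧
      ∀ C : List (Gate n), C.length ≤ k → (∀ g ∈ C, g.support.card ≤ b) → ∃ U ∈ T, ∀ x,
        traceDistance (applyUnitary (circuitUnitary C) x) (applyUnitary U x) ≤ k * η := by
  classical
  induction k with
  | zero =>
    refine ⟨{1}, by simp, fun C hC _ => ⟨1, by simp, fun x => ?_⟩⟩
    rw [List.length_eq_zero_iff.1 (Nat.le_zero.1 hC), circuitUnitary, traceDistance_self]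
    simp
  | succ k ih =>
    obtain ⟨T, hcard, hT⟩ := ih
    -- The identity accounts for the empty circuit; the count uses `1 + |T| |G| ≤ (|G| + 1) ^ (k +
    -- 1)`.
    refine ⟨insert 1 (Finset.image₂ (fun U g => U * Gate.unitary g) T G), ?_, ?_⟩
    · have h₁ := Finset.card_image₂_le (fun U g => U * Gate.unitary g) T G
      have h₂ := Nat.mul_le_mul_right G.card hcard
      have h₃ : 1 ≤ (G.card + 1) ^ k := Nat.one_le_pow _ _ (by omega)
      refine (Finset.card_insert_le _ _).trans ?_
      rw [pow_succ, mul_add_one]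
      omega
    · rintro (_ | ⟨g, C⟩) hC hb
      · refine ⟨1, Finset.mem_insert_self _ _, fun x => ?_⟩
        rw [circuitUnitary, traceDistance_self]
        positivity
      · obtain ⟨U, hU, hCU⟩ := hT C (by simpa using hC) fun g' hg' => hb g' (by simp [hg'])
        obtain ⟨g', hg', hgg'⟩ := hG g (hb g (by simp))
        refine ⟨U * g'.unitary, Finset.mem_insert_of_mem (Finset.mem_image₂_of_mem hU hg'),
          fun x => ?_⟩
        rw [circuitUnitary, applyUnitary_mul, applyUnitary_mul]
        -- In the intermediate state the first gate is exact and the rest approximate. The bound for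
        -- the rest is uniform in the state, and `U` preserves the error of the first gate.
        refine (traceDistance_triangle _ (applyUnitary U (applyUnitary g.unitary x)) _).trans ?_
        rw [traceDistance_applyUnitary]
        have h₁ := hCU (applyUnitary g.unitary x)
        have h₂ := hgg' x
        push_cast
        linarith

theorem mem_circuitClass_iff {b : ℕ} {c : ℝ} {f : PureState n → PureState n} :
    f ∈ circuitClass n b c ↔ ∃ C : List (Gate n), C.length ≤ ⌊(n : ℝ) ^ c⌋₊ ∧
      (∀ g ∈ C, g.support.card ≤ b) ∧ f = applyUnitary (circuitUnitary C) := by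
  simp only [circuitClass, Set.mem_ofPred_eq,
    Nat.le_floor_iff (Real.rpow_nonneg (Nat.cast_nonneg n) c)]

/-- Finite nets of the circuit class, in the uniform trace distance. -/
theorem exists_circuitClass_net (n b : ℕ) (c : ℝ) {N : ℕ} (hN : N = ⌊(n : ℝ) ^ c⌋₊) (hN0 : 0 < N)
    {ε : ℝ} (hε : ε ∈ Set.Ioo (0 : ℝ) 1) :
    ∃ T : Finset (unitaryGroup (Bits (Fin n)) ℂ),
      (T.card : ℝ) ≤ (128 * N * 2 ^ n / ε) ^ ((2 * (2 ^ b) ^ 2 + 2) * N) ∧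
      ∀ f ∈ circuitClass n b c, ∃ U ∈ T, ∀ x,
        traceDistance (f x) (applyUnitary U x) ≤ ε / 8 := by
  obtain ⟨hε0, hε1⟩ := hε
  have hN1 : (1 : ℝ) ≤ N := by exact_mod_cast hN0
  have h2n : (1 : ℝ) ≤ 2 ^ n := one_le_pow₀ (by norm_num)
  have hbase : 1 ≤ N * 2 ^ n / ε := by
    rw [one_le_div hε0]
    nlinarith
  -- This makes the gate error `2 · 2 ^ n · (2 / M)` at most `ε / (8 N)`, hence `ε / 8` over `N`
  -- gates.
  set M := ⌈32 * (N * 2 ^ n / ε)⌉₊ with hMdef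
  have hM : 32 * (N * 2 ^ n / ε) ≤ M := Nat.le_ceil _
  have hM2 : (M : ℝ) < 32 * (N * 2 ^ n / ε) + 1 := Nat.ceil_lt_add_one (by positivity)
  have hM0 : 0 < M := by
    have : (0 : ℝ) < M := by linarith
    exact_mod_cast this
  obtain ⟨G, hGcard, hG⟩ := exists_gate_net n b hM0
  have hM0' : (0 : ℝ) < M := by exact_mod_cast hM0
  have hη : 4 * 2 ^ n / (M : ℝ) ≤ ε / (8 * N) := by
    rw [div_le_div_iff₀ hM0' (by positivity)]
    have : 32 * (N * 2 ^ n / ε) * ε = 32 * (N * 2 ^ n) := by field_simp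
    nlinarith
  obtain ⟨T, hTcard, hT⟩ := exists_circuit_net (b := b) (G := G) (η := ε / (8 * N))
    (by positivity) (fun g hg => by
      obtain ⟨g', hg', h⟩ := hG g hg
      refine ⟨g', hg', fun x => (traceDistance_applyUnitary_le _ _ x).trans (le_trans ?_ hη)⟩
      calc _ ≤ 2 * (2 ^ n * (2 / (M : ℝ))) := by gcongr
        _ = _ := by ring) N
  refine ⟨T, ?_, fun f hf => ?_⟩
  · set B := 128 * N * 2 ^ n / ε with hB
    have hB' : B = 128 * (N * 2 ^ n / ε) := by rw [hB]; ring
    -- Both `2 M + 1` and `2 ^ n + 1` are at most `B`. Of the two extra powers, one absorbs the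
    -- supports and the added `1`; the other is slack.
    have hGB : (G.card : ℝ) + 1 ≤ B ^ (2 * (2 ^ b) ^ 2 + 2) := by
      have h₁ : (G.card : ℝ) ≤ 2 ^ n * (2 * M + 1) ^ (2 * (2 ^ b) ^ 2) := by exact_mod_cast hGcard
      have h₂ : (2 * (M : ℝ) + 1) ^ (2 * (2 ^ b) ^ 2) ≤ B ^ (2 * (2 ^ b) ^ 2) := by
        gcongr
        linarith
      have h₃ : (2 : ℝ) ^ n ≤ B - 1 := by
        have : (2 : ℝ) ^ n ≤ N * 2 ^ n / ε := by
          rw [le_div_iff₀ hε0]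
          nlinarith
        linarith
      have hB1 : 1 ≤ B := by linarith
      have h₄ : 1 ≤ B ^ (2 * (2 ^ b) ^ 2) := one_le_pow₀ hB1
      calc (G.card : ℝ) + 1 ≤ 2 ^ n * B ^ (2 * (2 ^ b) ^ 2) + 1 := by
            refine add_le_add (h₁.trans ?_) le_rfl
            gcongr
        _ ≤ (B - 1) * B ^ (2 * (2 ^ b) ^ 2) + B ^ (2 * (2 ^ b) ^ 2) := by gcongr
        _ = B * B ^ (2 * (2 ^ b) ^ 2) := by ring
        _ ≤ B ^ 2 * B ^ (2 * (2 ^ b) ^ 2) := by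
            gcongr
            nlinarith
        _ = _ := by rw [← pow_add, add_comm]
    calc (T.card : ℝ) ≤ ((G.card : ℝ) + 1) ^ N := by exact_mod_cast hTcard
      _ ≤ (B ^ (2 * (2 ^ b) ^ 2 + 2)) ^ N := by gcongr
      _ = _ := by rw [← pow_mul]
  · obtain ⟨C, hC, hb, rfl⟩ := mem_circuitClass_iff.1 hf
    obtain ⟨U, hU, h⟩ := hT C (hN ▸ hC) hb
    refine ⟨U, hU, fun x => (h x).trans (le_of_eq ?_)⟩
    field_simp

end Nets

/-! ### Existence of minimizers -/

section Minimizers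

instance compactSpace_unitaryGroup (ι : Type*) [Fintype ι] [DecidableEq ι] :
    CompactSpace (unitaryGroup ι ℂ) := by
  refine isCompact_iff_compactSpace.1 ?_
  have hK : IsCompact (Set.univ.pi fun _ : ι => Set.univ.pi fun _ : ι =>
      Metric.closedBall (0 : ℂ) 1) :=
    isCompact_univ_pi fun _ => isCompact_univ_pi fun _ => isCompact_closedBall _ _
  refine IsCompact.of_isClosed_subset (X := Matrix ι ι ℂ) hK ?_ fun U hU => ?_
  · have : (unitaryGroup ι ℂ : Set (Matrix ι ι ℂ)) = {U | U * star U = 1} :=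
      Set.ext fun U => mem_unitaryGroup_iff
    rw [this]
    exact isClosed_eq (continuous_id.matrix_mul continuous_id.matrix_conjTranspose)
      continuous_const
  · exact Set.mem_univ_pi.2 fun i => Set.mem_univ_pi.2 fun j =>
      mem_closedBall_zero_iff.2 (entry_norm_bound_of_unitary hU i j)

variable {n : ℕ}

theorem Gate.continuous_unitary (s : Finset (Fin n)) :
    Continuous fun U : unitaryGroup (Bits {i // i ∈ s}) ℂ => (Gate.mk s U).unitary := by
  refine Continuous.subtype_mk (continuous_matrix fun i j => ?_) _
  have h : Continuous fun U : unitaryGroup (Bits {i // i ∈ s}) ℂ => U.1 := continuous_subtype_val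
  exact (h.matrix_elem (fun k => i k) (fun k => j k)).mul_const
    ((1 : Matrix (Bits {k // k ∉ s}) (Bits {k // k ∉ s}) ℂ) (fun k => i k) (fun k => j k))

/-- A finite union, over the supports, of continuous images of compact unitary groups. -/
theorem isCompact_gate_unitaries (n b : ℕ) :
    IsCompact {U | ∃ g : Gate n, g.support.card ≤ b ∧ U = g.unitary} := by
  have h : {U | ∃ g : Gate n, g.support.card ≤ b ∧ U = g.unitary} =
      ⋃ s ∈ {s : Finset (Fin n) | s.card ≤ b}, Set.range fun U => (Gate.mk s U).unitary := by
    ext U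
    simp only [Set.mem_ofPred_eq, Set.mem_iUnion, Set.mem_range, exists_prop]
    constructor
    · rintro ⟨⟨s, V⟩, hs, rfl⟩
      exact ⟨s, hs, V, rfl⟩
    · rintro ⟨s, hs, V, rfl⟩
      exact ⟨⟨s, V⟩, hs, rfl⟩
  rw [h]
  exact (Set.toFinite _).isCompact_biUnion fun s _ => isCompact_range (Gate.continuous_unitary s)

-- The set for `k + 1` is `{1}` together with the product of the set for `k` and the compact set of
-- gates.
open scoped Pointwise in
theorem isCompact_circuit_unitaries (n b k : ℕ) :
    IsCompact {U | ∃ C : List (Gate n), C.length ≤ k ∧ (∀ g ∈ C, g.support.card ≤ b) ∧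
      U = circuitUnitary C} := by
  induction k with
  | zero =>
    convert isCompact_singleton (x := (1 : unitaryGroup (Bits (Fin n)) ℂ)) using 1
    ext U
    constructor
    · rintro ⟨C, hC, -, rfl⟩
      rw [List.length_eq_zero_iff.1 (Nat.le_zero.1 hC)]
      rfl
    · rintro rfl
      exact ⟨[], by simp, by simp, rfl⟩
  | succ k ih =>
    convert (isCompact_singleton (x := (1 : unitaryGroup (Bits (Fin n)) ℂ))).union
      (ih.mul (isCompact_gate_unitaries n b)) using 1
    ext U
    constructor
    · rintro ⟨_ | ⟨g, C⟩, hC, hb, rfl⟩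
      · exact .inl rfl
      · exact .inr ⟨_, ⟨C, by simpa using hC, fun g' hg' => hb g' (by simp [hg']), rfl⟩, _,
          ⟨g, hb g (by simp), rfl⟩, rfl⟩
    · rintro (rfl | ⟨_, ⟨C, hC, hb, rfl⟩, _, ⟨g, hg, rfl⟩, rfl⟩)
      · exact ⟨[], by simp, by simp, rfl⟩
      · exact ⟨g :: C, by simpa using hC, by simpa using ⟨hg, hb⟩, rfl⟩

theorem exists_isMinimizer_circuitClass (n b : ℕ) (c : ℝ) {R : (PureState n → PureState n) → ℝ}
    (hR : Continuous fun U => R (applyUnitary U)) : ∃ h, IsMinimizer (circuitClass n b c) R h := by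
  obtain ⟨U, ⟨C, hC, hb, rfl⟩, hmin⟩ :=
    (isCompact_circuit_unitaries n b ⌊(n : ℝ) ^ c⌋₊).exists_isMinOn
      ⟨1, [], by simp, by simp, rfl⟩ hR.continuousOn
  refine ⟨applyUnitary (circuitUnitary C), mem_circuitClass_iff.2 ⟨C, hC, hb, rfl⟩, fun g hg => ?_⟩
  obtain ⟨C', hC', hb', rfl⟩ := mem_circuitClass_iff.1 hg
  exact hmin ⟨C', hC', hb', rfl⟩

/-- Second countability makes open sets of the product measurable for the product σ-algebra, so that
the continuous loss is measurable. -/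
instance (n : ℕ) : SecondCountableTopology (PureState n) :=
  inferInstanceAs (SecondCountableTopology {ρ : Bits (Fin n) → Bits (Fin n) → ℂ //
    ∃ ψ : Bits (Fin n) → ℂ, star ψ ⬝ᵥ ψ = 1 ∧ ρ = vecMulVec ψ (star ψ)})

theorem measurable_traceDistance_applyUnitary (U : unitaryGroup (Bits (Fin n)) ℂ) :
    Measurable fun p : PureState n × PureState n => traceDistance p.2 (applyUnitary U p.1) :=
  (continuous_traceDistance continuous_snd
    (continuous_applyUnitary continuous_const continuous_fst)).measurable

/-- Dominated convergence: the loss is continuous in `U` and bounded by `1`. -/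
theorem continuous_risk_applyUnitary (P : Measure (PureState n × PureState n))
    [IsProbabilityMeasure P] :
    Continuous fun U : unitaryGroup (Bits (Fin n)) ℂ => risk traceDistance P (applyUnitary U) := by
  have : FirstCountableTopology (unitaryGroup (Bits (Fin n)) ℂ) :=
    inferInstanceAs (FirstCountableTopology {U : Bits (Fin n) → Bits (Fin n) → ℂ //
      U ∈ unitaryGroup (Bits (Fin n)) ℂ})
  refine continuous_of_dominated (bound := fun _ => 1)
    (fun U => (measurable_traceDistance_applyUnitary U).aestronglyMeasurable)
    (fun U => ae_of_all _ fun p => ?_) (integrable_const _)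
    (ae_of_all _ fun p => continuous_traceDistance continuous_const
      (continuous_applyUnitary continuous_id continuous_const))
  have h := traceDistance_mem_Icc p.2 (applyUnitary U p.1)
  rw [Real.norm_eq_abs, abs_of_nonneg h.1]
  exact h.2

theorem continuous_empiricalRisk_applyUnitary {m : ℕ} (S : Fin m → PureState n × PureState n) :
    Continuous fun U : unitaryGroup (Bits (Fin n)) ℂ =>
      empiricalRisk traceDistance S (applyUnitary U) :=
  continuous_const.mul (continuous_finsetSum _ fun _ _ => continuous_traceDistance continuous_const
    (continuous_applyUnitary continuous_id continuous_const))

end Minimizers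

/-! ### PAC learnability of the circuit class -/

/-- If there are no gates, the class consists of the identity only, and no samples are needed. -/
theorem pacLearnable_circuitClass_of_neg {n : ℕ} (hn : 2 ≤ n) (b : ℕ) {c : ℝ} (hc : c < 0) :
    PACLearnable (circuitClass n b c) traceDistance fun _ _ => 0 := by
  have hone : ⌊(n : ℝ) ^ c⌋₊ = 0 :=
    Nat.floor_eq_zero.2 (Real.rpow_lt_one_of_one_lt_of_neg (by exact_mod_cast hn) hc)
  have hid : ∀ f ∈ circuitClass n b c, f = applyUnitary 1 := by
    intro f hf
    obtain ⟨C, hC, -, rfl⟩ := mem_circuitClass_iff.1 hf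
    rw [hone, Nat.le_zero, List.length_eq_zero_iff] at hC
    rw [hC, circuitUnitary]
  intro ε hε δ hδ P hP
  refine ⟨exists_isMinimizer_circuitClass n b c (continuous_risk_applyUnitary P), fun m _ =>
    ⟨fun S => exists_isMinimizer_circuitClass n b c (continuous_empiricalRisk_applyUnitary S), ?_⟩⟩
  refine (measure_mono (t := ∅) ?_).trans (by simp)
  intro S hS
  refine hS fun h' h hh' hh => ?_
  rw [hid h' hh'.1, hid h hh.1, sub_self]
  exact hε.1.le

/-- Learnability with the sample size obtained from the covering number bound. -/
theorem pacLearnable_circuitClass {n : ℕ} (b : ℕ) (c : ℝ) {N : ℕ} (hN : N = ⌊(n : ℝ) ^ c⌋₊)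
    (hN0 : 0 < N) : PACLearnable (circuitClass n b c) traceDistance fun ε δ =>
      ⌊8 / ε ^ 2 * ((2 * (2 ^ b) ^ 2 + 2) * N * Real.log (128 * N * 2 ^ n / ε) + Real.log 2 +
        Real.log (1 / δ))⌋₊ + 1 := by
  classical
  intro ε hε δ hδ P hP
  refine ⟨exists_isMinimizer_circuitClass n b c (continuous_risk_applyUnitary P), fun m hm =>
    ⟨fun S => exists_isMinimizer_circuitClass n b c (continuous_empiricalRisk_applyUnitary S), ?_⟩⟩
  obtain ⟨T, hTcard, hT⟩ := exists_circuitClass_net n b c hN hN0 hε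
  have hε0 := hε.1
  have hδ0 := hδ.1
  -- The `+ 1` puts `m` above the real bound and also ensures `0 < m`, which Hoeffding's inequality
  -- needs.
  have hm' := (Nat.lt_floor_add_one _).trans_le
    ((Nat.cast_succ _).ge.trans (Nat.cast_le (α := ℝ).2 hm))
  refine (measure_erm_gap_le P (T.image applyUnitary) hε.1 traceDistance_mem_Icc ?_ ?_ ?_
    (Nat.succ_pos _ |>.trans_le hm)).trans (ENNReal.ofReal_le_ofReal ?_)
  · intro f hf
    obtain ⟨C, -, -, rfl⟩ := hf
    exact measurable_traceDistance_applyUnitary _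
  · intro f hf
    obtain ⟨U, -, rfl⟩ := Finset.mem_image.1 hf
    exact measurable_traceDistance_applyUnitary U
  · intro f hf
    obtain ⟨U, hU, h⟩ := hT f hf
    exact ⟨_, Finset.mem_image_of_mem _ hU, fun x y => (abs_traceDistance_sub_le _ _ _).trans (h x)⟩
  · set B := 128 * N * 2 ^ n / ε
    set k := 2 * (2 ^ b) ^ 2 + 2 with hk
    have hB : 0 < B := by positivity
    have h₁ : ((T.image applyUnitary).card : ℝ) ≤ B ^ (k * N) :=
      (Nat.cast_le.2 Finset.card_image_le).trans hTcard
    -- This says `log (2 B ^ (k N) / δ) ≤ m ε² / 8`, which is what the union bound requires.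
    have h₂ : (k : ℝ) * N * Real.log B + Real.log 2 + Real.log (1 / δ) ≤ m * ε ^ 2 / 8 := by
      rw [div_mul_eq_mul_div, div_lt_iff₀ (by positivity)] at hm'
      rw [hk]
      push_cast
      linarith
    have h₃ : Real.exp (-(m * ε ^ 2 / 8)) ≤ (B ^ (k * N))⁻¹ * 2⁻¹ * δ := by
      rw [← Real.log_le_log_iff (Real.exp_pos _) (by positivity), Real.log_exp,
        Real.log_mul (by positivity) hδ0.ne', Real.log_mul (by positivity) (by norm_num),
        Real.log_inv, Real.log_inv, Real.log_pow]
      rw [one_div, Real.log_inv] at h₂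
      push_cast
      linarith
    calc _ ≤ B ^ (k * N) * (2 * ((B ^ (k * N))⁻¹ * 2⁻¹ * δ)) := by gcongr
      _ = δ := by field_simp

/-- The sample size is of the order `ε⁻² (n ^ (c + 1) ln (n / ε) + ln (1 / δ))`. -/
theorem sampleSize_le (b : ℕ) {c : ℝ} (hc : 0 ≤ c) {n : ℕ} (hn : 2 ≤ n) {ε δ : ℝ}
    (hε : ε ∈ Set.Ioo (0 : ℝ) 1) (hδ : δ ∈ Set.Ioo (0 : ℝ) 1) :
    ((⌊8 / ε ^ 2 * ((2 * (2 ^ b) ^ 2 + 2) * ⌊(n : ℝ) ^ c⌋₊ *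
      Real.log (128 * ⌊(n : ℝ) ^ c⌋₊ * 2 ^ n / ε) + Real.log 2 + Real.log (1 / δ))⌋₊ + 1 : ℕ) : ℝ) ≤
      (8 * ((2 * (2 ^ b) ^ 2 + 2) * (9 + c)) + 10) *
        (1 / ε ^ 2 * ((n : ℝ) ^ (c + 1) * Real.log ((n : ℝ) / ε) + Real.log (1 / δ))) := by
  obtain ⟨hε0, hε1⟩ := hε
  obtain ⟨hδ0, hδ1⟩ := hδ
  have hn2 : (2 : ℝ) ≤ n := by exact_mod_cast hn
  have hn0 : (0 : ℝ) < n := by linarith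
  set N := ⌊(n : ℝ) ^ c⌋₊
  set A : ℝ := 2 * (2 ^ b) ^ 2 + 2
  set l := Real.log (n / ε) with hl
  set d := Real.log (1 / δ)
  have hA : 0 ≤ A := by positivity
  have hd : 0 ≤ d := Real.log_nonneg ((one_le_div hδ0).2 hδ1.le)
  have hl' : l = Real.log n + Real.log (1 / ε) := by
    rw [hl, one_div, div_eq_mul_inv, Real.log_mul hn0.ne' (by positivity)]
  have hle : 0 ≤ Real.log (1 / ε) := Real.log_nonneg ((one_le_div hε0).2 hε1.le)
  have hlog2 : Real.log 2 ≤ Real.log n := Real.log_le_log (by norm_num) hn2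
  have hlog2' : (1 / 2 : ℝ) ≤ Real.log 2 := by linarith [Real.log_two_gt_d9]
  have hp1 : 1 ≤ (n : ℝ) ^ c := Real.one_le_rpow (by linarith) hc
  have hp : (n : ℝ) ^ (c + 1) = n ^ c * n := by rw [Real.rpow_add_one hn0.ne']
  have hN : (N : ℝ) ≤ (n : ℝ) ^ c := Nat.floor_le (by positivity)
  have hN1 : (1 : ℝ) ≤ N := by exact_mod_cast Nat.le_floor (by simpa using hp1)
  have hlogN : Real.log N ≤ c * Real.log n := by
    rw [← Real.log_rpow hn0]
    exact Real.log_le_log (by linarith) hN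
  have hlogN0 : 0 ≤ Real.log N := Real.log_nonneg hN1
  have hlogB : Real.log (128 * N * 2 ^ n / ε) =
      7 * Real.log 2 + Real.log N + n * Real.log 2 + Real.log (1 / ε) := by
    rw [div_eq_mul_inv, Real.log_mul (by positivity) (by positivity),
      Real.log_mul (by positivity) (by positivity), Real.log_mul (by positivity) (by positivity),
      Real.log_pow, one_div, show (128 : ℝ) = 2 ^ 7 by norm_num, Real.log_pow]
    push_cast
    rfl
  -- The four terms of `hlogB` contribute `7`, `c`, `1` and `1` times `n * l`.
  have hlog : Real.log (128 * N * 2 ^ n / ε) ≤ (9 + c) * (n * l) := by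
    have h₁ : l ≤ n * l := le_mul_of_one_le_left (by linarith) (by linarith)
    have h₂ : n * Real.log 2 ≤ n * l := by gcongr; linarith
    have h₃ : c * Real.log n ≤ c * (n * l) := by gcongr; linarith
    rw [hlogB]
    linarith
  have hlog0 : 0 ≤ Real.log (128 * N * 2 ^ n / ε) := by
    rw [hlogB]
    have : 0 ≤ n * Real.log 2 := by positivity
    linarith
  set E := (n : ℝ) ^ (c + 1) * l with hE
  have hmain : A * N * Real.log (128 * N * 2 ^ n / ε) ≤ A * (9 + c) * E := by
    calc _ ≤ A * n ^ c * ((9 + c) * (n * l)) := by gcongr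
      _ = _ := by rw [hE, hp]; ring
  have hlE : l ≤ E :=
    le_mul_of_one_le_left (by linarith) (Real.one_le_rpow (by linarith) (by linarith))
  -- Since `log 2 ≥ 1 / 2`, the rounding term `1` is absorbed by `2 E`; with `8 E` from the term
  -- `log 2` this makes the constant `10`.
  have hE1 : 1 ≤ 2 * E := by linarith
  have hinv : 1 ≤ 1 / ε ^ 2 := (one_le_div (by positivity)).2 (pow_le_one₀ hε0.le hε1.le)
  have hfloor := Nat.floor_le (a := 8 / ε ^ 2 * (A * N * Real.log (128 * N * 2 ^ n / ε) +
    Real.log 2 + d)) (by positivity)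
  push_cast
  calc _ ≤ 8 / ε ^ 2 * (A * N * Real.log (128 * N * 2 ^ n / ε) + Real.log 2 + d) + 1 := by gcongr
    _ ≤ 8 / ε ^ 2 * (A * (9 + c) * E + E + d) + 1 / ε ^ 2 * (2 * E) := by
      gcongr
      · linarith
      · nlinarith
    _ = 1 / ε ^ 2 * ((8 * (A * (9 + c)) + 10) * E + 8 * d) := by ring
    _ ≤ 1 / ε ^ 2 * ((8 * (A * (9 + c)) + 10) * E + (8 * (A * (9 + c)) + 10) * d) := by
      gcongr
      have : 0 ≤ A * (9 + c) := by positivity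
      linarith
    _ = _ := by ring

theorem mainTheorem3 (b : ℕ) (c : ℝ) :
    ∃ K : ℝ, 0 < K ∧ ∀ n : ℕ, 2 ≤ n →
      ∃ ν : ℝ → ℝ → ℕ,
        PACLearnable (circuitClass n b c) traceDistance ν ∧
        ∀ ε ∈ Set.Ioo (0 : ℝ) 1, ∀ δ ∈ Set.Ioo (0 : ℝ) 1,
          (ν ε δ : ℝ) ≤ K * (1 / ε ^ 2 *
            ((n : ℝ) ^ (c + 1) * Real.log ((n : ℝ) / ε) + Real.log (1 / δ))) := by
  rcases lt_or_ge c 0 with hc | hc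
  · refine ⟨1, one_pos, fun n hn => ⟨_, pacLearnable_circuitClass_of_neg hn b hc,
      fun ε hε δ hδ => ?_⟩⟩
    have hn1 : (1 : ℝ) ≤ n := by exact_mod_cast (by omega : 1 ≤ n)
    have h₁ : 0 ≤ Real.log (n / ε) :=
      Real.log_nonneg ((one_le_div hε.1).2 (hε.2.le.trans hn1))
    have h₂ : 0 ≤ Real.log (1 / δ) := Real.log_nonneg ((one_le_div hδ.1).2 hδ.2.le)
    rw [Nat.cast_zero]
    positivity
  · refine ⟨8 * ((2 * (2 ^ b) ^ 2 + 2) * (9 + c)) + 10, by positivity, fun n hn =>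
      ⟨_, pacLearnable_circuitClass b c rfl (Nat.floor_pos.2 ?_),
        fun ε hε δ hδ => sampleSize_le b hc hn hε hδ⟩⟩
    exact Real.one_le_rpow (by exact_mod_cast (by omega : 1 ≤ n)) hc
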